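/- Let $S$ be a finite set, $J : S \to \mathbb{R}_{\ge 0}$ an objective function, and let $G$ be a connected, vertex-transitive, $d$-regular graph (undirected, without loops) on $S$, of diameter $D$; write $N(x)$ for the set of neighbours of $x$ in $G$. For $\beta \ge 0$ let $P_\beta$ be the transition matrix of simulated annealing on $S$ with state graph $G$ at fixed inverse temperature $\beta$: $$P_\beta(x,y) = \tfrac1d \min\{1, e^{-\beta (J(y)-J(x))}\}\ \ (y \in N(x)),\qquad P_\beta(x,y) = 0\ \ (y \notin N(x)\cup\{x\}),\qquad P_\beta(x,x) = 1 - \sum_{z \in N(x)} P_\beta(x,z).$$ Its stationary distribution is $\pi_\beta(x) = e^{-\beta J(x)} / \sum_{z\in S} e^{-\beta J(z)}$. The lazy version of the chain has transition matrix $\tfrac12(I + P_\beta)$ and the same stationary distribution. For a transition matrix $P$ with stationary distribution $\pi$, the mixing time is $$\tau(\varepsilon) = \min\Bigl\{ r \in \mathbb{N} : \sup_{\nu} \|\nu P^r - \pi\|_{\mathrm{TV}} \le \varepsilon \Bigr\},$$ the supremum being over all probability distributions $\nu$ on $S$. Let $t \ge 1$, let $a > 0$ satisfy $a \ge J_{\max}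 := \max_{x\in S} J(x)$, let $\beta = \ln t / a$, and let $0 < \varepsilon \le 1$. (i) If $G$ is not bipartite (or $|S| = 1$), then the mixing time of $P_{\beta}$ is finite and satisfies $$\tau(\varepsilon) \le 128\, d^2 D^4 t^2 \ln\!\left(\frac{|S|\, t}{\varepsilon}\right).$$ (ii) Without any assumption on bipartiteness, the mixing time of the lazy chain $\tfrac12(I+P_\beta)$ is finite and satisfies the same bound. -/

import Mathlib

open Matrix

/-- The graph `G` is vertex-transitive: its automorphisms act transitively on the vertices. -/
def VertexTransitive {S : Type*} (G : SimpleGraph S) : Prop :=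
  ∀ x y : S, ∃ φ : G ≃g G, φ x = y

/-- Transition matrix of simulated annealing with state graph `G` (so `N(x)` is the set of
`G`-neighbours of `x`) and objective `J`, at fixed inverse temperature `β`: a neighbour `y` of the
current state `x` is proposed uniformly at random and accepted with probability
`min {1, exp (-β (J y - J x))}`; otherwise the chain stays at `x`. -/
noncomputable def annealingMatrix {S : Type*} [Fintype S] [DecidableEq S]
    (G : SimpleGraph S) [DecidableRel G.Adj] (J : S → ℝ) (β : ℝ) : Matrix S S ℝ :=
  Matrix.of fun x y =>
    if y = x then
      1 - ∑ z ∈ G.neighborFinset x,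
        (1 / (G.degree x : ℝ)) * min 1 (Real.exp (-(β * (J z - J x))))
    else if G.Adj x y then
      (1 / (G.degree x : ℝ)) * min 1 (Real.exp (-(β * (J y - J x))))
    else 0

/-- The lazy version of a chain: at each step, stay put with probability `1/2`, and otherwise
perform a step of the original chain. -/
noncomputable def lazyMatrix {S : Type*} [DecidableEq S] (P : Matrix S S ℝ) : Matrix S S ℝ :=
  (1 / 2 : ℝ) • (1 + P)

/-- The partition function `Z(β) = ∑ₓ exp (-β J x)`. -/
noncomputable def partitionFunction {S : Type*} [Fintype S] (J : S → ℝ) (β : ℝ) : ℝ :=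
  ∑ x, Real.exp (-(β * J x))

/-- The equilibrium distribution `π_β(x) = exp (-β J x) / Z(β)`. -/
noncomputable def gibbs {S : Type*} [Fintype S] (J : S → ℝ) (β : ℝ) : S → ℝ :=
  fun x => Real.exp (-(β * J x)) / partitionFunction J β

/-- `π` is a stationary distribution of the transition matrix `P`. -/
def IsStationaryDist {S : Type*} [Fintype S] (P : Matrix S S ℝ) (π : S → ℝ) : Prop :=
  π ∈ stdSimplex ℝ S ∧ π ᵥ* P = π

/-- Total variation distance of two distributions on a finite set. -/
noncomputable def tvDist {S : Type*} [Fintype S] (μ ν : S → ℝ) : ℝ :=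
  (1 / 2) * ∑ x, |μ x - ν x|

/-- `d(r) = sup_ν ‖ν P^r - π‖_TV`, the supremum over all probability distributions `ν` on `S`. -/
noncomputable def worstDist {S : Type*} [Fintype S] [DecidableEq S]
    (P : Matrix S S ℝ) (π : S → ℝ) (r : ℕ) : ℝ :=
  ⨆ ν : stdSimplex ℝ S, tvDist ((ν : S → ℝ) ᵥ* P ^ r) π

/-- `τ = min {r : d(r) ≤ ε}`; in particular the minimum exists. -/
def IsMixingTime {S : Type*} [Fintype S] [DecidableEq S]
    (P : Matrix S S ℝ) (π : S → ℝ) (ε : ℝ) (τ : ℕ) : Prop :=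
  IsLeast {r : ℕ | worstDist P π r ≤ ε} τ

/-- Rows of the annealing matrix sum to one. -/
theorem annealingMatrix_row_sum {S : Type*} [Fintype S] [DecidableEq S]
    (G : SimpleGraph S) [DecidableRel G.Adj] (J : S → ℝ) (β : ℝ) (x : S) :
    ∑ y, annealingMatrix G J β x y = 1 := by
  rw [← Finset.add_sum_erase _ _ (Finset.mem_univ x)]
  have h : ∑ y ∈ Finset.univ.erase x, annealingMatrix G J β x y =
      ∑ z ∈ G.neighborFinset x,
        (1 / (G.degree x : ℝ)) * min 1 (Real.exp (-(β * (J z - J x)))) := by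
    rw [SimpleGraph.neighborFinset_eq_filter, Finset.sum_filter,
      ← Finset.add_sum_erase (a := x) _ _ (Finset.mem_univ x)]
    simp only [SimpleGraph.irrefl, if_false, zero_add]
    refine Finset.sum_congr rfl fun y hy => ?_
    simp [annealingMatrix, Finset.ne_of_mem_erase hy]
  rw [h]
  simp [annealingMatrix]

/-- Entries of the annealing matrix are nonnegative. -/
theorem annealingMatrix_nonneg {S : Type*} [Fintype S] [DecidableEq S]
    (G : SimpleGraph S) [DecidableRel G.Adj] (J : S → ℝ) (β : ℝ) (x y : S) :
    0 ≤ annealingMatrix G J β x y := by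
  unfold annealingMatrix
  simp only [Matrix.of_apply]
  split_ifs
  · have h : ∑ z ∈ G.neighborFinset x,
        (1 / (G.degree x : ℝ)) * min 1 (Real.exp (-(β * (J z - J x)))) ≤
        ∑ z ∈ G.neighborFinset x, (1 / (G.degree x : ℝ)) :=
      Finset.sum_le_sum fun z _ =>
        mul_le_of_le_one_right (by positivity) (min_le_left _ _)
    rw [Finset.sum_const, G.card_neighborFinset_eq_degree, nsmul_eq_mul] at h
    have h2 : (G.degree x : ℝ) * (1 / (G.degree x : ℝ)) ≤ 1 := by
      rw [mul_one_div]
      exact div_self_le_one _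
    linarith
  · positivity
  · exact le_rfl

/-- On a regular state graph the chain satisfies detailed balance with respect to `gibbs`. -/
theorem gibbs_detailed_balance {S : Type*} [Fintype S] [DecidableEq S]
    (G : SimpleGraph S) [DecidableRel G.Adj] {d : ℕ} (hd : G.IsRegularOfDegree d)
    (J : S → ℝ) (β : ℝ) (x y : S) :
    gibbs J β x * annealingMatrix G J β x y = gibbs J β y * annealingMatrix G J β y x := by
  have key : ∀ x y : S, Real.exp (-(β * J x)) * min 1 (Real.exp (-(β * (J y - J x)))) =
      min (Real.exp (-(β * J x))) (Real.exp (-(β * J y))) := by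
    intro x y
    rw [mul_min_of_nonneg _ _ (Real.exp_pos _).le, mul_one, ← Real.exp_add]
    congr 2
    ring
  by_cases hxy : y = x
  · subst hxy; rfl
  · have hyx : ¬ x = y := fun h => hxy h.symm
    by_cases hadj : G.Adj x y
    · have h1 := key x y
      have h2 := key y x
      simp only [annealingMatrix, Matrix.of_apply, hxy, hyx, hadj, hadj.symm, if_true, if_false,
        gibbs, hd.degree_eq]
      calc _ = (1 / (d : ℝ)) / partitionFunction J β *
            (Real.exp (-(β * J x)) * min 1 (Real.exp (-(β * (J y - J x))))) := by ring
        _ = (1 / (d : ℝ)) / partitionFunction J β *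
            (Real.exp (-(β * J y)) * min 1 (Real.exp (-(β * (J x - J y))))) := by
          rw [h1, h2, min_comm]
        _ = _ := by ring
    · have hadj' : ¬ G.Adj y x := fun h => hadj h.symm
      simp [annealingMatrix, hxy, hyx, hadj, hadj']

/-- On a regular state graph, `gibbs` is a stationary distribution of the annealing chain. -/
theorem gibbs_isStationaryDist {S : Type*} [Fintype S] [DecidableEq S] [Nonempty S]
    (G : SimpleGraph S) [DecidableRel G.Adj] {d : ℕ} (hd : G.IsRegularOfDegree d)
    (J : S → ℝ) (β : ℝ) : IsStationaryDist (annealingMatrix G J β) (gibbs J β) := by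
  have hZ : 0 < partitionFunction J β :=
    Finset.sum_pos (fun x _ => Real.exp_pos _) Finset.univ_nonempty
  refine ⟨⟨fun x => div_nonneg (Real.exp_pos _).le hZ.le, ?_⟩, ?_⟩
  · simp only [gibbs, ← Finset.sum_div]
    exact div_self hZ.ne'
  · funext y
    simp only [Matrix.vecMul, dotProduct]
    rw [Finset.sum_congr rfl fun x _ => gibbs_detailed_balance G hd J β x y, ← Finset.mul_sum,
      annealingMatrix_row_sum, mul_one]

/-- A stationary distribution of a chain is stationary for its lazy version. -/
theorem IsStationaryDist.lazy {S : Type*} [Fintype S] [DecidableEq S] {P : Matrix S S ℝ}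
    {π : S → ℝ} (h : IsStationaryDist P π) : IsStationaryDist (lazyMatrix P) π := by
  refine ⟨h.1, ?_⟩
  rw [lazyMatrix, Matrix.vecMul_smul, Matrix.vecMul_add, Matrix.vecMul_one, h.2, ← two_smul ℝ π,
    smul_smul]
  norm_num

/-! ### Averaging over automorphisms -/

/-! The chain is reversible, so mixing reduces to keeping its quadratic form on mean-zero functions
away from both 1 and -1. A sign `σ = ±1` treats both ends at once: the form with differences `f x -
σ * f y` belongs to `1 - σ P`.

Vertex-transitivity replaces a choice of canonical paths. Move one walk by all automorphisms: its
vertices become equidistributed, so each edge contributes on average at most `edgeEnergy / |S|`, and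
Cauchy–Schwarz costs the squared length (`sum_iso_walk_le`). Geodesics give the Poincaré inequality
(`poincare`); an odd closed walk, which exists when `G` is not bipartite, gives the bound at -1
(`sum_sq_le_edgeEnergy_neg_one`). For the lazy chain the diagonal alone suffices there.

The Gibbs weights lie in `[1/t, 1]` before normalization, so passing from counting measure to
`gibbs` costs only `d * t`. Hence the gap is at least `1 / K` with `K = 9 d D² t`, and the mixing
time is at most `K log(|S| t / ε) + 1`, which is stronger than the stated bound up to absorbing the
1. -/

/-- The Dirichlet-type sum of `f` over the oriented edges of `G`, with sign `σ`. -/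
noncomputable def edgeEnergy {S : Type*} [Fintype S] (G : SimpleGraph S) [DecidableRel G.Adj]
    (σ : ℝ) (f : S → ℝ) : ℝ :=
  ∑ u, ∑ w ∈ G.neighborFinset u, (f u - σ * f w) ^ 2

instance SimpleGraph.Iso.instFinite {S : Type*} [Finite S] (G : SimpleGraph S) :
    Finite (G ≃g G) :=
  Finite.of_injective (fun φ : G ≃g G => (φ : S → S)) DFunLike.coe_injective

/-- The image of a vertex under a uniform automorphism is uniform: precomposing with an automorphism
carrying `x` to `y` shows that the left sum does not depend on `x`, so it can be averaged over all
vertices. -/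
theorem VertexTransitive.card_mul_sum_iso {S : Type*} [Fintype S] {G : SimpleGraph S}
    [Fintype (G ≃g G)] (h : VertexTransitive G) (F : S → ℝ) (x : S) :
    (Fintype.card S : ℝ) * ∑ φ : G ≃g G, F (φ x) = Fintype.card (G ≃g G) * ∑ y, F y := by
  have h1 : ∀ y, ∑ φ : G ≃g G, F (φ y) = ∑ φ : G ≃g G, F (φ x) := by
    intro y
    obtain ⟨ψ, hψ⟩ := h x y
    let e : (G ≃g G) ≃ (G ≃g G) :=
      { toFun := fun φ => ψ.trans φ
        invFun := fun φ => ψ.symm.trans φ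
        left_inv := fun φ => by ext; simp
        right_inv := fun φ => by ext; simp }
    rw [← Equiv.sum_comp e (fun φ : G ≃g G => F (φ x))]
    refine Finset.sum_congr rfl fun φ _ => ?_
    simp [e, hψ]
  have h2 : ∑ y, ∑ φ : G ≃g G, F (φ y) = (Fintype.card S : ℝ) * ∑ φ : G ≃g G, F (φ x) := by
    rw [Finset.sum_congr rfl fun y _ => h1 y]
    simp
  rw [← h2, Finset.sum_comm]
  have h3 : ∀ φ : G ≃g G, ∑ y, F (φ y) = ∑ y, F y := fun φ => Equiv.sum_comp φ.toEquiv F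
  rw [Finset.sum_congr rfl fun φ _ => h3 φ]
  simp

/-- Only the base point `φ x` is equidistributed, since `G` need not be edge-transitive; the image
edge is therefore bounded by the sum over all edges at `φ x`. -/
theorem VertexTransitive.sum_iso_edge_le {S : Type*} [Fintype S] {G : SimpleGraph S}
    [DecidableRel G.Adj] [Fintype (G ≃g G)] (h : VertexTransitive G) (σ : ℝ) (f : S → ℝ)
    {x y : S} (hxy : G.Adj x y) :
    (Fintype.card S : ℝ) * ∑ φ : G ≃g G, (f (φ x) - σ * f (φ y)) ^ 2 ≤
      Fintype.card (G ≃g G) * edgeEnergy G σ f := by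
  rw [edgeEnergy,
    ← h.card_mul_sum_iso (fun u => ∑ w ∈ G.neighborFinset u, (f u - σ * f w) ^ 2) x]
  refine mul_le_mul_of_nonneg_left (Finset.sum_le_sum fun φ _ => ?_) (Nat.cast_nonneg _)
  exact Finset.single_le_sum (f := fun w => (f (φ x) - σ * f w) ^ 2)
    (fun w _ => sq_nonneg _) (by simpa using φ.map_adj_iff.2 hxy)

theorem sq_add_le_of_pos {k : ℝ} (hk : 0 < k) (a b : ℝ) :
    (a + b) ^ 2 ≤ (k + 1) * a ^ 2 + (k + 1) / k * b ^ 2 := by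
  have h : (k + 1) * a ^ 2 + (k + 1) / k * b ^ 2 - (a + b) ^ 2 = (k * a - b) ^ 2 / k := by
    field_simp
    ring
  have := div_nonneg (sq_nonneg (k * a - b)) hk.le
  linarith

/-- Cauchy–Schwarz along the walk, done by induction: adding an edge to a walk of length `k` with
weights `k + 1` and `(k + 1) / k` turns `k ^ 2` into exactly `(k + 1) ^ 2`. -/
theorem VertexTransitive.sum_iso_walk_le {S : Type*} [Fintype S] {G : SimpleGraph S}
    [DecidableRel G.Adj] [Fintype (G ≃g G)] (h : VertexTransitive G) {σ : ℝ} (hσ : σ ^ 2 = 1)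
    (f : S → ℝ) {x y : S} (p : G.Walk x y) :
    (Fintype.card S : ℝ) * ∑ φ : G ≃g G, (f (φ x) - σ ^ p.length * f (φ y)) ^ 2 ≤
      (p.length : ℝ) ^ 2 * (Fintype.card (G ≃g G) * edgeEnergy G σ f) := by
  induction p with
  | nil => simp
  | @cons u v w huv p ih =>
    have he := h.sum_iso_edge_le σ f huv
    have hsplit : ∀ φ : G ≃g G, f (φ u) - σ ^ (p.length + 1) * f (φ w) =
        (f (φ u) - σ * f (φ v)) + σ * (f (φ v) - σ ^ p.length * f (φ w)) := fun φ => by ring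
    rw [SimpleGraph.Walk.length_cons]
    simp only [hsplit]
    -- The weight `(k + 1) / k` needs `k > 0`, so a single edge is treated apart.
    rcases Nat.eq_zero_or_pos p.length with h0 | h0
    · obtain rfl := SimpleGraph.Walk.eq_of_length_eq_zero h0
      simpa [h0] using he
    · have hk : (0 : ℝ) < p.length := by exact_mod_cast h0
      set k : ℝ := (p.length : ℝ)
      set M : ℝ := Fintype.card (G ≃g G) * edgeEnergy G σ f
      calc _ ≤ (Fintype.card S : ℝ) * ∑ φ : G ≃g G, ((k + 1) * (f (φ u) - σ * f (φ v)) ^ 2 +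
            (k + 1) / k * (f (φ v) - σ ^ p.length * f (φ w)) ^ 2) := by
            refine mul_le_mul_of_nonneg_left (Finset.sum_le_sum fun φ _ => ?_) (Nat.cast_nonneg _)
            refine (sq_add_le_of_pos hk _ _).trans_eq ?_
            rw [mul_pow, hσ, one_mul]
        _ = (k + 1) * ((Fintype.card S : ℝ) * ∑ φ : G ≃g G, (f (φ u) - σ * f (φ v)) ^ 2) +
            (k + 1) / k * ((Fintype.card S : ℝ) *
              ∑ φ : G ≃g G, (f (φ v) - σ ^ p.length * f (φ w)) ^ 2) := by
            rw [Finset.sum_add_distrib, ← Finset.mul_sum, ← Finset.mul_sum]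
            ring
        _ ≤ (k + 1) * M + (k + 1) / k * (k ^ 2 * M) := by gcongr
        _ = _ := by
            push_cast
            field_simp
            ring

/-! ### Odd closed walks and Poincaré-type inequalities -/

theorem edgeEnergy_nonneg {S : Type*} [Fintype S] (G : SimpleGraph S) [DecidableRel G.Adj]
    (σ : ℝ) (f : S → ℝ) : 0 ≤ edgeEnergy G σ f :=
  Finset.sum_nonneg fun _ _ => Finset.sum_nonneg fun _ _ => sq_nonneg _

theorem SimpleGraph.Connected.dist_le_diam_of_finite {S : Type*} [Finite S] {G : SimpleGraph S}
    (hG : G.Connected) (x y : S) : G.dist x y ≤ G.diam :=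
  have := hG.nonempty
  SimpleGraph.dist_le_diam (SimpleGraph.connected_iff_ediam_ne_top.1 hG)

/-- In a connected graph that is not bipartite, each vertex lies on an odd closed walk of length
at most twice the diameter plus one. -/
theorem SimpleGraph.Connected.exists_odd_closed_walk {S : Type*} [Finite S]
    {G : SimpleGraph S} (hG : G.Connected) (hb : ¬ G.IsBipartite) (x : S) :
    ∃ p : G.Walk x x, Odd p.length ∧ p.length ≤ 2 * G.diam + 1 := by
  by_contra hcon
  push Not at hcon
  refine hb ?_
  have hc : ∀ {u v : S}, G.Adj u v →
      decide (Even (G.dist x u)) ≠ decide (Even (G.dist x v)) := by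
    -- An edge between vertices at distances of equal parity from `x` closes two geodesics into an
    -- odd walk; without short odd walks, distance parity is a 2-colouring.
    intro u v huv heq
    have hpar : Even (G.dist x u) ↔ Even (G.dist x v) := by simpa using heq
    obtain ⟨p, hp⟩ := hG.exists_walk_length_eq_dist x u
    obtain ⟨q, hq⟩ := hG.exists_walk_length_eq_dist x v
    have hu := hG.dist_le_diam_of_finite x u
    have hv := hG.dist_le_diam_of_finite x v
    have hlen : (p.append (SimpleGraph.Walk.cons huv q.reverse)).length =
        G.dist x u + (G.dist x v + 1) := by
      simp [hp, hq]
    have := hcon (p.append (SimpleGraph.Walk.cons huv q.reverse))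
      (by rw [hlen]; grind)
    omega
  exact (SimpleGraph.Coloring.mk (fun v => decide (Even (G.dist x v))) hc).colorable

/-- Around an odd closed walk the alternating difference is `f x - (-1) * f x = 2 * f x`, so no
mean-zero condition is needed. -/
theorem VertexTransitive.sum_sq_le_edgeEnergy_neg_one {S : Type*} [Fintype S] {G : SimpleGraph S}
    [DecidableRel G.Adj] (h : VertexTransitive G) (hG : G.Connected) (hb : ¬ G.IsBipartite)
    (f : S → ℝ) :
    4 * ∑ x, f x ^ 2 ≤ (2 * (G.diam : ℝ) + 1) ^ 2 * edgeEnergy G (-1) f := by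
  classical
  have := Fintype.ofFinite (G ≃g G)
  obtain ⟨x⟩ := hG.nonempty
  obtain ⟨p, hodd, hlen⟩ := hG.exists_odd_closed_walk hb x
  have h1 := h.sum_iso_walk_le (σ := -1) (by norm_num) f p
  have h2 := h.card_mul_sum_iso (fun y => 4 * f y ^ 2) x
  have h3 : ∀ φ : G ≃g G, (f (φ x) - (-1) ^ p.length * f (φ x)) ^ 2 = 4 * f (φ x) ^ 2 := by
    intro φ
    rw [hodd.neg_one_pow]
    ring
  rw [Finset.sum_congr rfl fun φ _ => h3 φ, h2, mul_left_comm, ← Finset.mul_sum] at h1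
  have hpos : (0 : ℝ) < Fintype.card (G ≃g G) := by
    have : Nonempty (G ≃g G) := ⟨SimpleGraph.Iso.refl⟩
    exact_mod_cast Fintype.card_pos
  refine (le_of_mul_le_mul_left h1 hpos).trans ?_
  have hE := edgeEnergy_nonneg G (-1) f
  have : (p.length : ℝ) ≤ 2 * G.diam + 1 := by exact_mod_cast hlen
  gcongr

/-- Poincaré inequality on a vertex-transitive graph, for a probability vector dominated by
a multiple of the counting measure. -/
theorem VertexTransitive.poincare {S : Type*} [Fintype S] {G : SimpleGraph S}
    [DecidableRel G.Adj] (h : VertexTransitive G) (hG : G.Connected)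
    {π f : S → ℝ} {b : ℝ} (hsum : ∑ x, π x = 1) (hπ : ∀ x, π x ≤ b)
    (hf : ∑ x, π x * f x = 0) :
    ∑ x, π x * f x ^ 2 ≤ b * ((G.diam : ℝ) ^ 2 * edgeEnergy G 1 f) := by
  classical
  have := Fintype.ofFinite (G ≃g G)
  obtain ⟨z⟩ := hG.nonempty
  have hcS : (0 : ℝ) < Fintype.card S := by
    have : Nonempty S := ⟨z⟩
    exact_mod_cast Fintype.card_pos
  have hpos : (0 : ℝ) < Fintype.card (G ≃g G) := by
    have : Nonempty (G ≃g G) := ⟨SimpleGraph.Iso.refl⟩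
    exact_mod_cast Fintype.card_pos
  have hE := edgeEnergy_nonneg G 1 f
  have hb : 0 ≤ b := by
    by_contra hb
    push Not at hb
    have : ∑ x, π x ≤ 0 := Finset.sum_nonpos fun x _ => (hπ x).trans hb.le
    linarith
  -- The second moment about any `c` dominates the variance; it is later used with `c = f (φ z)` and
  -- averaged over `φ`.
  have hvar : ∀ c : ℝ, ∑ x, π x * f x ^ 2 ≤ b * ∑ x, (c - f x) ^ 2 := by
    intro c
    have h1 : ∑ x, π x * (c - f x) ^ 2 = ∑ x, π x * f x ^ 2 + c ^ 2 := by
      calc _ = ∑ x, (π x * f x ^ 2 + (c ^ 2 * π x - 2 * c * (π x * f x))) :=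
            Finset.sum_congr rfl fun x _ => by ring
        _ = _ := by
          rw [Finset.sum_add_distrib, Finset.sum_sub_distrib, ← Finset.mul_sum, ← Finset.mul_sum,
            hsum, hf]
          ring
    have h2 : ∑ x, π x * (c - f x) ^ 2 ≤ b * ∑ x, (c - f x) ^ 2 := by
      rw [Finset.mul_sum]
      exact Finset.sum_le_sum fun x _ => mul_le_mul_of_nonneg_right (hπ x) (sq_nonneg _)
    nlinarith [sq_nonneg c]
  have hpair : ∀ x, (Fintype.card S : ℝ) * ∑ φ : G ≃g G, (f (φ z) - f (φ x)) ^ 2 ≤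
      (G.diam : ℝ) ^ 2 * (Fintype.card (G ≃g G) * edgeEnergy G 1 f) := by
    intro x
    obtain ⟨p, hp⟩ := hG.exists_walk_length_eq_dist z x
    have h1 := h.sum_iso_walk_le (σ := 1) (by norm_num) f p
    simp only [one_pow, one_mul] at h1
    refine h1.trans ?_
    have : (p.length : ℝ) ≤ G.diam := by
      rw [hp]
      exact_mod_cast hG.dist_le_diam_of_finite z x
    gcongr
  have htot : ∑ φ : G ≃g G, ∑ x, (f (φ z) - f x) ^ 2 ≤
      (G.diam : ℝ) ^ 2 * (Fintype.card (G ≃g G) * edgeEnergy G 1 f) := by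
    have h1 : ∀ φ : G ≃g G, ∑ x, (f (φ z) - f x) ^ 2 = ∑ x, (f (φ z) - f (φ x)) ^ 2 :=
      fun φ => (Equiv.sum_comp φ.toEquiv fun x => (f (φ z) - f x) ^ 2).symm
    rw [Finset.sum_congr rfl fun φ _ => h1 φ, Finset.sum_comm]
    refine le_of_mul_le_mul_left ?_ hcS
    rw [Finset.mul_sum]
    refine (Finset.sum_le_sum fun x _ => hpair x).trans_eq ?_
    simp
  have hfin : (Fintype.card (G ≃g G) : ℝ) * ∑ x, π x * f x ^ 2 ≤
      b * ((G.diam : ℝ) ^ 2 * (Fintype.card (G ≃g G) * edgeEnergy G 1 f)) := by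
    refine le_trans ?_ (mul_le_mul_of_nonneg_left htot hb)
    calc _ = ∑ _φ : G ≃g G, ∑ x, π x * f x ^ 2 := by
          rw [Finset.sum_const, Finset.card_univ, nsmul_eq_mul]
      _ ≤ _ := ?_
    rw [Finset.mul_sum]
    exact Finset.sum_le_sum fun φ _ => hvar _
  refine le_of_mul_le_mul_left (hfin.trans_eq ?_) hpos
  ring

/-! ### Mixing of reversible chains -/

/-- `P` is a transition matrix that is reversible with respect to the positive probability
vector `π`. -/
structure IsReversibleChain {S : Type*} [Fintype S] (P : Matrix S S ℝ) (π : S → ℝ) : Prop where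
  nonneg : ∀ x y, 0 ≤ P x y
  row_sum : ∀ x, ∑ y, P x y = 1
  pos : ∀ x, 0 < π x
  sum_eq_one : ∑ x, π x = 1
  balance : ∀ x y, π x * P x y = π y * P y x

namespace IsReversibleChain

variable {S : Type*} [Fintype S] {P : Matrix S S ℝ} {π : S → ℝ}

theorem mul_mulVec (h : IsReversibleChain P π) (f : S → ℝ) (y : S) :
    π y * (P *ᵥ f) y = ((fun x => π x * f x) ᵥ* P) y := by
  simp only [Matrix.mulVec, Matrix.vecMul, dotProduct, Finset.mul_sum]
  refine Finset.sum_congr rfl fun x _ => ?_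
  rw [← mul_assoc, h.balance]
  ring

theorem mul_pow_mulVec [DecidableEq S] (h : IsReversibleChain P π) (f : S → ℝ) (r : ℕ) (y : S) :
    π y * (P ^ r *ᵥ f) y = ((fun x => π x * f x) ᵥ* P ^ r) y := by
  induction r generalizing y with
  | zero => simp
  | succ r ih =>
    have h1 : (fun x => π x * (P ^ r *ᵥ f) x) = (fun x => π x * f x) ᵥ* P ^ r := funext ih
    rw [pow_succ', ← Matrix.mulVec_mulVec, h.mul_mulVec, h1, Matrix.vecMul_vecMul,
      ← pow_succ, ← pow_succ']

theorem sum_mul_mulVec (h : IsReversibleChain P π) (f : S → ℝ) :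
    ∑ y, π y * (P *ᵥ f) y = ∑ x, π x * f x := by
  simp only [h.mul_mulVec, Matrix.vecMul, dotProduct]
  rw [Finset.sum_comm]
  simp only [← Finset.mul_sum, h.row_sum, mul_one]

theorem inner_mulVec_comm (h : IsReversibleChain P π) (f g : S → ℝ) :
    ∑ x, π x * (f x * (P *ᵥ g) x) = ∑ x, π x * (g x * (P *ᵥ f) x) := by
  have h1 : ∀ u v : S → ℝ, ∑ x, π x * (u x * (P *ᵥ v) x) =
      ∑ x, ∑ y, π x * P x y * (u x * v y) := by
    intro u v
    simp only [Matrix.mulVec, dotProduct, Finset.mul_sum]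
    exact Finset.sum_congr rfl fun x _ => Finset.sum_congr rfl fun y _ => by ring
  rw [h1, h1, Finset.sum_comm]
  refine Finset.sum_congr rfl fun x _ => Finset.sum_congr rfl fun y _ => ?_
  rw [h.balance]
  ring

/-- Lower bounds on this form for `σ = 1` and `σ = -1` are the two sides of the bound on `|⟨f, P
f⟩|`. -/
theorem dirichlet_form_eq (h : IsReversibleChain P π) {σ : ℝ} (hσ : σ ^ 2 = 1) (f : S → ℝ) :
    ∑ x, ∑ y, π x * P x y * (f x - σ * f y) ^ 2 =
      2 * ∑ x, π x * f x ^ 2 - 2 * σ * ∑ x, π x * (f x * (P *ᵥ f) x) := by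
  have h1 : ∑ x, ∑ y, π x * P x y * f x ^ 2 = ∑ x, π x * f x ^ 2 := by
    refine Finset.sum_congr rfl fun x _ => ?_
    rw [← Finset.sum_mul, ← Finset.mul_sum, h.row_sum, mul_one]
  have h2 : ∑ x, ∑ y, π x * P x y * f y ^ 2 = ∑ x, π x * f x ^ 2 := by
    rw [Finset.sum_comm, ← h1]
    refine Finset.sum_congr rfl fun x _ => Finset.sum_congr rfl fun y _ => ?_
    rw [h.balance]
  have h3 : ∑ x, ∑ y, π x * P x y * (f x * f y) = ∑ x, π x * (f x * (P *ᵥ f) x) := by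
    simp only [Matrix.mulVec, dotProduct, Finset.mul_sum]
    exact Finset.sum_congr rfl fun x _ => Finset.sum_congr rfl fun y _ => by ring
  calc _ = ∑ x, ∑ y, (π x * P x y * f x ^ 2 + π x * P x y * f y ^ 2 -
        2 * σ * (π x * P x y * (f x * f y))) := by
        refine Finset.sum_congr rfl fun x _ => Finset.sum_congr rfl fun y _ => ?_
        linear_combination (π x * P x y * f y ^ 2) * hσ
    _ = _ := by
        simp only [Finset.sum_sub_distrib, Finset.sum_add_distrib, ← Finset.mul_sum, h1, h2, h3]
        ring

/-- A bound on the quadratic form on mean-zero functions bounds the operator norm there. -/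
theorem sum_sq_mulVec_le (h : IsReversibleChain P π) {ρ : ℝ} (hρ : 0 < ρ)
    (hquad : ∀ f : S → ℝ, ∑ x, π x * f x = 0 →
      |∑ x, π x * (f x * (P *ᵥ f) x)| ≤ ρ * ∑ x, π x * f x ^ 2)
    {f : S → ℝ} (hf : ∑ x, π x * f x = 0) :
    ∑ x, π x * (P *ᵥ f) x ^ 2 ≤ ρ ^ 2 * ∑ x, π x * f x ^ 2 := by
  set g : S → ℝ := P *ᵥ f with hg
  have hg0 : ∑ x, π x * g x = 0 := by rw [hg, h.sum_mul_mulVec, hf]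
  set c : ℝ := ρ⁻¹
  have hρc : ρ * c = 1 := mul_inv_cancel₀ hρ.ne'
  have hmean : ∀ s : ℝ, ∑ x, π x * (f + s • g) x = 0 := by
    intro s
    simp only [Pi.add_apply, Pi.smul_apply, smul_eq_mul, mul_add, Finset.sum_add_distrib, hf,
      mul_left_comm _ s, ← Finset.mul_sum, hg0]
    ring
  have hform : ∀ s : ℝ, ∑ x, π x * ((f + s • g) x * (P *ᵥ (f + s • g)) x) =
      ∑ x, π x * (f x * (P *ᵥ f) x) + 2 * s * ∑ x, π x * g x ^ 2 +
        s ^ 2 * ∑ x, π x * (g x * (P *ᵥ g) x) := by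
    intro s
    have hfg : ∑ x, π x * (f x * (P *ᵥ g) x) = ∑ x, π x * g x ^ 2 := by
      rw [h.inner_mulVec_comm, ← hg]
      exact Finset.sum_congr rfl fun x _ => by ring
    calc _ = ∑ x, (π x * (f x * (P *ᵥ f) x) + s * (π x * (f x * (P *ᵥ g) x)) +
          s * (π x * g x ^ 2) + s ^ 2 * (π x * (g x * (P *ᵥ g) x))) := by
          refine Finset.sum_congr rfl fun x _ => ?_
          rw [Matrix.mulVec_add, Matrix.mulVec_smul, ← hg]
          simp only [Pi.add_apply, Pi.smul_apply, smul_eq_mul]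
          ring
      _ = _ := by
          simp only [Finset.sum_add_distrib, ← Finset.mul_sum, hfg]
          ring
  have hnorm : ∀ s : ℝ, ∑ x, π x * (f + s • g) x ^ 2 =
      ∑ x, π x * f x ^ 2 + 2 * s * ∑ x, π x * (f x * g x) + s ^ 2 * ∑ x, π x * g x ^ 2 := by
    intro s
    calc _ = ∑ x, (π x * f x ^ 2 + 2 * s * (π x * (f x * g x)) + s ^ 2 * (π x * g x ^ 2)) := by
          refine Finset.sum_congr rfl fun x _ => ?_
          simp only [Pi.add_apply, Pi.smul_apply, smul_eq_mul]
          ring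
      _ = _ := by simp only [Finset.sum_add_distrib, ← Finset.mul_sum]
  -- Polarization: subtracting the form at `f - c • g` from that at `f + c • g` isolates `4 * c *
  -- B`; `c = ρ⁻¹` leaves `B ≤ ρ ^ 2 * A`.
  have h1 := (abs_le.1 (hquad _ (hmean c))).2
  have h2 := (abs_le.1 (hquad _ (hmean (-c)))).1
  rw [hform, hnorm] at h1 h2
  set A := ∑ x, π x * f x ^ 2
  set B := ∑ x, π x * g x ^ 2
  have h3 : 4 * c * B ≤ 2 * ρ * A + 2 * ρ * c ^ 2 * B := by linarith
  have h4 : ρ * (4 * c * B) ≤ ρ * (2 * ρ * A + 2 * ρ * c ^ 2 * B) :=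
    mul_le_mul_of_nonneg_left h3 hρ.le
  have h5 : ρ * (4 * c * B) = 4 * B := by linear_combination 4 * B * hρc
  have h6 : ρ * (2 * ρ * A + 2 * ρ * c ^ 2 * B) = 2 * ρ ^ 2 * A + 2 * B := by
    linear_combination 2 * B * (ρ * c + 1) * hρc
  linarith

theorem sum_sq_pow_mulVec_le [DecidableEq S] (h : IsReversibleChain P π) {ρ : ℝ} (hρ : 0 < ρ)
    (hquad : ∀ f : S → ℝ, ∑ x, π x * f x = 0 →
      |∑ x, π x * (f x * (P *ᵥ f) x)| ≤ ρ * ∑ x, π x * f x ^ 2)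
    {f : S → ℝ} (hf : ∑ x, π x * f x = 0) (r : ℕ) :
    ∑ x, π x * (P ^ r *ᵥ f) x ^ 2 ≤ (ρ ^ r) ^ 2 * ∑ x, π x * f x ^ 2 ∧
      ∑ x, π x * (P ^ r *ᵥ f) x = 0 := by
  induction r with
  | zero => simpa using hf
  | succ r ih =>
    rw [pow_succ', ← Matrix.mulVec_mulVec]
    refine ⟨?_, by rw [h.sum_mul_mulVec, ih.2]⟩
    refine (h.sum_sq_mulVec_le hρ hquad ih.2).trans ?_
    calc _ ≤ ρ ^ 2 * ((ρ ^ r) ^ 2 * ∑ x, π x * f x ^ 2) := by gcongr; exact ih.1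
      _ = _ := by ring

/-- The centred density `ν / π - 1` has mean zero and `L²(π)` norm at most `m`; it contracts by `ρ`
per step, and the `L¹` norm is at most the `L²` norm. -/
theorem worstDist_le [DecidableEq S] (h : IsReversibleChain P π) {ρ m : ℝ} (hρ : 0 < ρ)
    (hm : 0 ≤ m) (hπ : ∀ x, 1 ≤ m ^ 2 * π x)
    (hquad : ∀ f : S → ℝ, ∑ x, π x * f x = 0 →
      |∑ x, π x * (f x * (P *ᵥ f) x)| ≤ ρ * ∑ x, π x * f x ^ 2) (r : ℕ) :
    worstDist P π r ≤ ρ ^ r * m := by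
  have hnn : 0 ≤ ρ ^ r * m := by positivity
  refine Real.iSup_le (fun ν => ?_) hnn
  change tvDist (ν.1 ᵥ* P ^ r) π ≤ ρ ^ r * m
  obtain ⟨hν0, hν1⟩ := ν.2
  generalize ν.1 = ν at hν0 hν1 ⊢
  set f : S → ℝ := fun x => ν x / π x - 1 with hfdef
  have hπf : ∀ x, π x * f x = ν x - π x := by
    intro x
    have := (h.pos x).ne'
    simp only [hfdef]
    field_simp
  have hf : ∑ x, π x * f x = 0 := by
    simp only [hπf, Finset.sum_sub_distrib, hν1, h.sum_eq_one, sub_self]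
  have hstat : ∀ y, (π ᵥ* P ^ r) y = π y := by
    intro y
    have h1 := h.mul_pow_mulVec (fun _ => 1) r y
    simp only [mul_one] at h1
    rw [← h1]
    have h2 : P ^ r *ᵥ (fun _ => (1 : ℝ)) = fun _ => 1 := by
      clear h1
      induction r with
      | zero => simp
      | succ r ih =>
        rw [pow_succ, ← Matrix.mulVec_mulVec]
        have : P *ᵥ (fun _ => (1 : ℝ)) = fun _ => 1 := by
          funext x
          simp [Matrix.mulVec, dotProduct, h.row_sum]
        rw [this]
        exact ih (by positivity)
    simp [h2]
  have hdiff : ∀ y, (ν ᵥ* P ^ r) y - π y = π y * (P ^ r *ᵥ f) y := by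
    intro y
    have h1 : (fun x => π x * f x) = ν - π := funext hπf
    rw [h.mul_pow_mulVec, h1, Matrix.sub_vecMul, Pi.sub_apply, hstat]
  have hnorm : ∑ x, π x * f x ^ 2 ≤ m ^ 2 := by
    calc _ ≤ ∑ x, (m ^ 2 * ν x + (π x - 2 * ν x)) := by
          refine Finset.sum_le_sum fun x _ => ?_
          have hp := h.pos x
          have h1 : π x * f x ^ 2 = ν x * (ν x / π x) + (π x - 2 * ν x) := by
            simp only [hfdef]
            field_simp
            ring
          have hνx : 0 ≤ ν x := hν0 x
          have hνle : ν x ≤ 1 := by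
            rw [← hν1]
            exact Finset.single_le_sum (fun i _ => hν0 i) (Finset.mem_univ x)
          have h2 : ν x / π x ≤ m ^ 2 := by
            rw [div_le_iff₀ hp]
            exact hνle.trans (hπ x)
          rw [h1]
          nlinarith
      _ ≤ _ := by
          simp only [Finset.sum_add_distrib, Finset.sum_sub_distrib, ← Finset.mul_sum, hν1,
            h.sum_eq_one]
          linarith
  have hL1 : (∑ x, π x * |(P ^ r *ᵥ f) x|) ^ 2 ≤ (ρ ^ r * m) ^ 2 := by
    have hcs : (∑ x, π x * |(P ^ r *ᵥ f) x|) ^ 2 ≤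
        (∑ x, π x) * ∑ x, π x * (P ^ r *ᵥ f) x ^ 2 := by
      refine Finset.sum_sq_le_sum_mul_sum_of_sq_le_mul _ (fun x _ => (h.pos x).le)
        (fun x _ => mul_nonneg (h.pos x).le (sq_nonneg _)) fun x _ => ?_
      rw [mul_pow, sq_abs]
      exact le_of_eq (by ring)
    rw [h.sum_eq_one, one_mul] at hcs
    refine hcs.trans ((h.sum_sq_pow_mulVec_le hρ hquad hf r).1.trans ?_)
    rw [mul_pow]
    gcongr
  have hL1' := abs_le_of_sq_le_sq' hL1 hnn
  have htv : tvDist (ν ᵥ* P ^ r) π = 1 / 2 * ∑ x, π x * |(P ^ r *ᵥ f) x| := by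
    unfold tvDist
    congr 1
    refine Finset.sum_congr rfl fun x _ => ?_
    rw [hdiff, abs_mul, abs_of_pos (h.pos x)]
  rw [htv]
  linarith [hL1'.2]

theorem exists_isMixingTime_le [DecidableEq S] (h : IsReversibleChain P π) {K M ε : ℝ}
    (hK : 1 < K) (hM : 1 ≤ M) (hε : 0 < ε) (hε1 : ε ≤ 1) (hπ : ∀ x, 1 ≤ M * π x)
    (hgap : ∀ σ : ℝ, σ = 1 ∨ σ = -1 → ∀ f : S → ℝ, ∑ x, π x * f x = 0 →
      2 * ∑ x, π x * f x ^ 2 ≤ K * ∑ x, ∑ y, π x * P x y * (f x - σ * f y) ^ 2) :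
    ∃ τ : ℕ, IsMixingTime P π ε τ ∧ (τ : ℝ) ≤ K * Real.log (M / ε) + 1 := by
  have hK0 : 0 < K := by linarith
  have hρ : 0 < 1 - 1 / K := by
    rw [sub_pos, div_lt_one hK0]
    exact hK
  have hquad : ∀ f : S → ℝ, ∑ x, π x * f x = 0 →
      |∑ x, π x * (f x * (P *ᵥ f) x)| ≤ (1 - 1 / K) * ∑ x, π x * f x ^ 2 := by
    intro f hf
    have h1 := hgap 1 (Or.inl rfl) f hf
    have h2 := hgap (-1) (Or.inr rfl) f hf
    rw [h.dirichlet_form_eq (by norm_num)] at h1 h2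
    have key : ∀ A B : ℝ, 2 * A ≤ K * B → 1 / K * A ≤ B / 2 := by
      intro A B hAB
      rw [one_div, inv_mul_le_iff₀ hK0]
      linarith
    have h3 := key _ _ h1
    have h4 := key _ _ h2
    rw [abs_le]
    constructor <;> linarith
  have hlog : 0 ≤ Real.log (M / ε) := Real.log_nonneg (by rw [le_div_iff₀ hε]; linarith)
  set r : ℕ := ⌈K * Real.log (M / ε)⌉₊ with hr
  have hrle : (r : ℝ) ≤ K * Real.log (M / ε) + 1 := (Nat.ceil_lt_add_one (by positivity)).le
  have hrge : K * Real.log (M / ε) ≤ r := Nat.le_ceil _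
  have hworst : worstDist P π r ≤ ε := by
    refine (h.worstDist_le hρ (Real.sqrt_nonneg M)
      (by simpa [Real.sq_sqrt (zero_le_one.trans hM)] using hπ) hquad r).trans ?_
    have h1 : (1 - 1 / K) ^ r ≤ ε / M := by
      calc (1 - 1 / K) ^ r ≤ Real.exp (-(1 / K)) ^ r := by
            gcongr
            linarith [Real.add_one_le_exp (-(1 / K))]
        _ = Real.exp (-(r / K)) := by
            rw [← Real.exp_nat_mul]
            congr 1
            ring
        _ ≤ Real.exp (-Real.log (M / ε)) := by
            refine Real.exp_le_exp.2 (neg_le_neg ?_)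
            rw [le_div_iff₀ hK0]
            linarith
        _ = ε / M := by
            rw [Real.exp_neg, Real.exp_log (by positivity), inv_div]
    -- The density bound only requires `√M`; the cruder `M` matches the logarithm `log (M / ε)`.
    have hsq : Real.sqrt M ≤ M := by
      rw [Real.sqrt_le_left (by linarith)]
      nlinarith
    calc _ ≤ ε / M * M := by gcongr
      _ = ε := by field_simp
  have hne : {r : ℕ | worstDist P π r ≤ ε}.Nonempty := ⟨r, hworst⟩
  refine ⟨sInf {r : ℕ | worstDist P π r ≤ ε}, ⟨Nat.sInf_mem hne, fun _ hs => Nat.sInf_le hs⟩, ?_⟩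
  refine le_trans ?_ hrle
  exact_mod_cast Nat.sInf_le hworst

/-! ### Laziness and spectral gaps at both ends -/

theorem lazy [DecidableEq S] (h : IsReversibleChain P π) :
    IsReversibleChain (lazyMatrix P) π where
  nonneg x y := by
    have h1 := h.nonneg x y
    have h2 : (0 : ℝ) ≤ (1 : Matrix S S ℝ) x y := by
      rw [Matrix.one_apply]
      positivity
    simp only [lazyMatrix, Matrix.smul_apply, Matrix.add_apply, smul_eq_mul]
    positivity
  row_sum x := by
    simp only [lazyMatrix, Matrix.smul_apply, Matrix.add_apply, smul_eq_mul, ← Finset.mul_sum,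
      Finset.sum_add_distrib, h.row_sum, Matrix.one_apply]
    norm_num
  pos := h.pos
  sum_eq_one := h.sum_eq_one
  balance x y := by
    have h1 := h.balance x y
    simp only [lazyMatrix, Matrix.smul_apply, Matrix.add_apply, smul_eq_mul]
    by_cases hxy : x = y
    · rw [hxy]
    · rw [Matrix.one_apply_ne hxy, Matrix.one_apply_ne (Ne.symm hxy)]
      linear_combination (1 / 2) * h1

theorem mul_edgeEnergy_le (h : IsReversibleChain P π) {G : SimpleGraph S} [DecidableRel G.Adj]
    {c : ℝ} (hc : ∀ x y, G.Adj x y → c ≤ π x * P x y) (σ : ℝ) (f : S → ℝ) :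
    c * edgeEnergy G σ f ≤ ∑ x, ∑ y, π x * P x y * (f x - σ * f y) ^ 2 := by
  rw [edgeEnergy, Finset.mul_sum]
  refine Finset.sum_le_sum fun x _ => ?_
  rw [Finset.mul_sum]
  refine (Finset.sum_le_sum fun y hy => ?_).trans
    (Finset.sum_le_sum_of_subset_of_nonneg (Finset.subset_univ (G.neighborFinset x))
      fun y _ _ => mul_nonneg (mul_nonneg (h.pos x).le (h.nonneg x y)) (sq_nonneg _))
  exact mul_le_mul_of_nonneg_right (hc x y (by simpa using hy)) (sq_nonneg _)

/-- Spectral gap at `1` of a reversible chain on a vertex-transitive graph. -/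
theorem gap_one (h : IsReversibleChain P π) {G : SimpleGraph S} [DecidableRel G.Adj]
    (hG : G.Connected) (ht : VertexTransitive G) {b c K : ℝ} (hb : ∀ x, π x ≤ b)
    (hc : ∀ x y, G.Adj x y → c ≤ π x * P x y) (hK : 0 ≤ K)
    (hbc : 2 * b * (G.diam : ℝ) ^ 2 ≤ K * c)
    {f : S → ℝ} (hf : ∑ x, π x * f x = 0) :
    2 * ∑ x, π x * f x ^ 2 ≤ K * ∑ x, ∑ y, π x * P x y * (f x - 1 * f y) ^ 2 := by
  have h1 := ht.poincare hG h.sum_eq_one hb hf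
  have h2 := mul_le_mul_of_nonneg_left (h.mul_edgeEnergy_le hc 1 f) hK
  have h3 := mul_le_mul_of_nonneg_right hbc (edgeEnergy_nonneg G 1 f)
  linarith

/-- Spectral gap at `-1` of a reversible chain on a vertex-transitive graph that is not
bipartite. -/
theorem gap_neg_one (h : IsReversibleChain P π) {G : SimpleGraph S} [DecidableRel G.Adj]
    (hG : G.Connected) (ht : VertexTransitive G) (hbip : ¬ G.IsBipartite) {b c K : ℝ}
    (hb : ∀ x, π x ≤ b) (hc : ∀ x y, G.Adj x y → c ≤ π x * P x y) (hK : 0 ≤ K)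
    (hbc : b * (2 * (G.diam : ℝ) + 1) ^ 2 ≤ 2 * (K * c)) (f : S → ℝ) :
    2 * ∑ x, π x * f x ^ 2 ≤ K * ∑ x, ∑ y, π x * P x y * (f x - (-1) * f y) ^ 2 := by
  obtain ⟨z⟩ := hG.nonempty
  have hb0 : 0 ≤ b := (h.pos z).le.trans (hb z)
  have h0 : ∑ x, π x * f x ^ 2 ≤ b * ∑ x, f x ^ 2 := by
    rw [Finset.mul_sum]
    exact Finset.sum_le_sum fun x _ => mul_le_mul_of_nonneg_right (hb x) (sq_nonneg _)
  have h1 := mul_le_mul_of_nonneg_left (ht.sum_sq_le_edgeEnergy_neg_one hG hbip f) hb0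
  have h2 := mul_le_mul_of_nonneg_left (h.mul_edgeEnergy_le hc (-1) f) hK
  have h3 := mul_le_mul_of_nonneg_right hbc (edgeEnergy_nonneg G (-1) f)
  linarith

/-- A lazy chain has a spectral gap at `-1`. -/
theorem gap_neg_one_of_half_le (h : IsReversibleChain P π) (hP : ∀ x, 1 / 2 ≤ P x x) {K : ℝ}
    (hK : 1 ≤ K) (f : S → ℝ) :
    2 * ∑ x, π x * f x ^ 2 ≤ K * ∑ x, ∑ y, π x * P x y * (f x - (-1) * f y) ^ 2 := by
  have h1 : 2 * ∑ x, π x * f x ^ 2 ≤ ∑ x, ∑ y, π x * P x y * (f x - (-1) * f y) ^ 2 := by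
    rw [Finset.mul_sum]
    refine Finset.sum_le_sum fun x _ => ?_
    -- Keep only the diagonal term, which is `π x * P x x * (2 * f x) ^ 2`.
    refine le_trans ?_ (Finset.single_le_sum (f := fun y => π x * P x y * (f x - (-1) * f y) ^ 2)
      (fun y _ => mul_nonneg (mul_nonneg (h.pos x).le (h.nonneg x y)) (sq_nonneg _))
      (Finset.mem_univ x))
    have := mul_le_mul_of_nonneg_left (hP x) (mul_nonneg (h.pos x).le (sq_nonneg (f x)))
    linarith
  have h2 : 0 ≤ ∑ x, π x * f x ^ 2 :=
    Finset.sum_nonneg fun x _ => mul_nonneg (h.pos x).le (sq_nonneg _)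
  nlinarith

end IsReversibleChain

/-! ### The annealing chain -/

theorem annealingMatrix_isReversibleChain {S : Type*} [Fintype S] [DecidableEq S] [Nonempty S]
    (G : SimpleGraph S) [DecidableRel G.Adj] {d : ℕ} (hd : G.IsRegularOfDegree d)
    (J : S → ℝ) (β : ℝ) : IsReversibleChain (annealingMatrix G J β) (gibbs J β) where
  nonneg := annealingMatrix_nonneg G J β
  row_sum := annealingMatrix_row_sum G J β
  pos _ := div_pos (Real.exp_pos _)
    (Finset.sum_pos (fun _ _ => Real.exp_pos _) Finset.univ_nonempty)
  sum_eq_one := (gibbs_isStationaryDist G hd J β).1.2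
  balance := gibbs_detailed_balance G hd J β

theorem gibbs_mul_annealingMatrix_of_adj {S : Type*} [Fintype S] [DecidableEq S]
    (G : SimpleGraph S) [DecidableRel G.Adj] {d : ℕ} (hd : G.IsRegularOfDegree d)
    (J : S → ℝ) (β : ℝ) {x y : S} (h : G.Adj x y) :
    gibbs J β x * annealingMatrix G J β x y =
      min (Real.exp (-(β * J x))) (Real.exp (-(β * J y))) / (d * partitionFunction J β) := by
  have key : Real.exp (-(β * J x)) * min 1 (Real.exp (-(β * (J y - J x)))) =
      min (Real.exp (-(β * J x))) (Real.exp (-(β * J y))) := by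
    rw [mul_min_of_nonneg _ _ (Real.exp_pos _).le, mul_one, ← Real.exp_add]
    congr 2
    ring
  rw [← key]
  simp only [annealingMatrix, Matrix.of_apply, h.ne', h, if_true, if_false, gibbs, hd.degree_eq]
  ring

/-- Over a one-point state space every chain that has a stationary distribution is mixed at
time zero. -/
theorem isMixingTime_zero_of_subsingleton {S : Type*} [Fintype S] [DecidableEq S]
    [Subsingleton S] (P : Matrix S S ℝ) {π : S → ℝ} (hπ : ∑ x, π x = 1) {ε : ℝ} (hε : 0 ≤ ε) :
    IsMixingTime P π ε 0 := by
  refine ⟨?_, fun _ _ => Nat.zero_le _⟩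
  refine Real.iSup_le (fun ν => ?_) hε
  change tvDist (ν.1 ᵥ* P ^ 0) π ≤ ε
  have hν := ν.2.2
  generalize ν.1 = ν at hν ⊢
  have h : ν = π := by
    funext x
    rw [Fintype.sum_subsingleton _ x] at hν hπ
    rw [hν, hπ]
  simpa [tvDist, h] using hε

theorem mainTheorem4 {S : Type*} [Fintype S] [DecidableEq S]
    (G : SimpleGraph S) [DecidableRel G.Adj] (J : S → ℝ) (hJ : ∀ x, 0 ≤ J x)
    (d D : ℕ) (hconn : G.Connected) (hd : G.IsRegularOfDegree d) (hD : G.diam = D)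
    (htrans : VertexTransitive G)
    (a t ε : ℝ) (ha : 0 < a) (hJa : (⨆ x, J x) ≤ a) (ht : 1 ≤ t) (hε : 0 < ε) (hε1 : ε ≤ 1) :
    ((Subsingleton S ∨ ¬ G.IsBipartite) →
      ∃ τ : ℕ, IsMixingTime (annealingMatrix G J (Real.log t / a)) (gibbs J (Real.log t / a)) ε τ ∧
        (τ : ℝ) ≤ 128 * (d : ℝ) ^ 2 * (D : ℝ) ^ 4 * t ^ 2
          * Real.log ((Fintype.card S : ℝ) * t / ε)) ∧
    (∃ τ : ℕ, IsMixingTime (lazyMatrix (annealingMatrix G J (Real.log t / a)))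
        (gibbs J (Real.log t / a)) ε τ ∧
        (τ : ℝ) ≤ 128 * (d : ℝ) ^ 2 * (D : ℝ) ^ 4 * t ^ 2
          * Real.log ((Fintype.card S : ℝ) * t / ε)) := by
  subst hD
  have hne : Nonempty S := hconn.nonempty
  set β := Real.log t / a
  have hrev := annealingMatrix_isReversibleChain G hd J β
  rcases subsingleton_or_nontrivial S with hS | hS
  -- Here the diameter is 0, so the bound vanishes and the mixing time must be 0.
  · have hlog : 0 ≤ Real.log ((Fintype.card S : ℝ) * t / ε) := by
      refine Real.log_nonneg ?_
      have hcard : (1 : ℝ) ≤ Fintype.card S := by exact_mod_cast Fintype.card_pos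
      rw [le_div_iff₀ hε]
      nlinarith
    have hmix : ∀ P : Matrix S S ℝ, ∃ τ : ℕ, IsMixingTime P (gibbs J β) ε τ ∧
        (τ : ℝ) ≤ 128 * (d : ℝ) ^ 2 * (G.diam : ℝ) ^ 4 * t ^ 2
          * Real.log ((Fintype.card S : ℝ) * t / ε) := fun P =>
      ⟨0, isMixingTime_zero_of_subsingleton P hrev.sum_eq_one hε.le, by
        rw [Nat.cast_zero]; positivity⟩
    exact ⟨fun _ => hmix _, hmix _⟩
  have ht0 : 0 < t := by linarith
  have hβ : 0 ≤ β := div_nonneg (Real.log_nonneg ht) ha.le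
  have hw1 : ∀ x, Real.exp (-(β * J x)) ≤ 1 := fun x =>
    Real.exp_le_one_iff.2 (neg_nonpos.2 (mul_nonneg hβ (hJ x)))
  have hwt : ∀ x, 1 / t ≤ Real.exp (-(β * J x)) := by
    intro x
    have h1 : J x ≤ a := (le_ciSup (Set.finite_range J).bddAbove x).trans hJa
    have h2 : β * J x ≤ Real.log t := by
      calc β * J x ≤ β * a := by gcongr
        _ = Real.log t := div_mul_cancel₀ _ ha.ne'
    calc 1 / t = Real.exp (-Real.log t) := by rw [Real.exp_neg, Real.exp_log ht0, one_div]
      _ ≤ _ := Real.exp_le_exp.2 (neg_le_neg h2)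
  set Z := partitionFunction J β
  have hZ : 0 < Z := Finset.sum_pos (fun _ _ => Real.exp_pos _) Finset.univ_nonempty
  have hZn : Z ≤ Fintype.card S := by
    calc Z ≤ ∑ _x : S, (1 : ℝ) := Finset.sum_le_sum fun x _ => hw1 x
      _ = (Fintype.card S : ℝ) := by simp
  have hd1 : (1 : ℝ) ≤ d := by
    obtain ⟨x⟩ := hne
    have := hconn.preconnected.degree_pos_of_nontrivial x
    rw [hd.degree_eq] at this
    exact_mod_cast this
  have hD1 : (1 : ℝ) ≤ G.diam := by
    obtain ⟨x, y, hxy⟩ := exists_pair_ne S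
    have h1 := hconn.pos_dist_of_ne hxy
    have h2 := hconn.dist_le_diam_of_finite x y
    exact_mod_cast h1.trans_le h2
  have hcard : (2 : ℝ) ≤ Fintype.card S := by
    exact_mod_cast Fintype.one_lt_card (α := S)
  set n : ℝ := (Fintype.card S : ℝ)
  set L := Real.log (n * t / ε)
  have hL : 1 / 2 ≤ L := by
    have h2 : Real.log 2 ≤ L := by
      refine Real.log_le_log two_pos ?_
      rw [le_div_iff₀ hε]
      nlinarith
    linarith [Real.log_two_gt_d9]
  have hdDt : 1 ≤ (d : ℝ) * (G.diam : ℝ) ^ 2 * t :=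
    one_le_mul_of_one_le_of_one_le (one_le_mul_of_one_le_of_one_le hd1 (one_le_pow₀ hD1)) ht
  set q : ℝ := (d : ℝ) * (G.diam : ℝ) ^ 2 * t with hq
  have hb : ∀ x, gibbs J β x ≤ 1 / Z := fun x => by
    unfold gibbs
    gcongr
    exact hw1 x
  have hmin : ∀ x, 1 ≤ n * t * gibbs J β x := by
    intro x
    have h1 : 1 / t / n ≤ gibbs J β x := by
      unfold gibbs
      gcongr
      exact hwt x
    calc 1 = n * t * (1 / t / n) := by field_simp
      _ ≤ _ := by gcongr
  have hc : ∀ x y, G.Adj x y → 1 / t / (d * Z) ≤ gibbs J β x * annealingMatrix G J β x y := by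
    intro x y hxy
    rw [gibbs_mul_annealingMatrix_of_adj G hd J β hxy]
    gcongr
    exact le_min (hwt x) (hwt y)
  have hcl : ∀ x y, G.Adj x y →
      1 / t / (d * Z) / 2 ≤ gibbs J β x * lazyMatrix (annealingMatrix G J β) x y := by
    intro x y hxy
    have := hc x y hxy
    simp only [lazyMatrix, Matrix.smul_apply, Matrix.add_apply, smul_eq_mul,
      Matrix.one_apply_ne hxy.ne]
    linarith
  have hKc : 9 * q * (1 / t / (d * Z)) = 9 * (G.diam : ℝ) ^ 2 * (1 / Z) := by
    rw [hq]
    field_simp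
  have hZinv : 0 < 1 / Z := by positivity
  -- The source of the 9 in `K = 9 * q`: the odd walk has length at most `2D + 1 ≤ 3D`.
  have hD2 : (2 * (G.diam : ℝ) + 1) ^ 2 ≤ 9 * (G.diam : ℝ) ^ 2 := by nlinarith
  have hD2Z : 0 ≤ (G.diam : ℝ) ^ 2 * (1 / Z) := by positivity
  -- Since `L ≥ 1/2` and `q ≥ 1`, the added 1 is at most `2 * q * L`; then `q ≤ q ^ 2` gives the
  -- stated form.
  have hfinal : 9 * q * L + 1 ≤ 128 * (d : ℝ) ^ 2 * (G.diam : ℝ) ^ 4 * t ^ 2 * L := by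
    have h1 : 128 * (d : ℝ) ^ 2 * (G.diam : ℝ) ^ 4 * t ^ 2 * L = 128 * q ^ 2 * L := by
      rw [hq]
      ring
    have h2 : q ≤ q ^ 2 := by nlinarith
    have h3 : q * L ≤ q ^ 2 * L := by gcongr
    have h4 : L ≤ q * L := by nlinarith
    rw [h1]
    linarith
  have hM : 1 ≤ n * t := by nlinarith
  constructor
  · intro hbip
    replace hbip := hbip.resolve_left (not_subsingleton S)
    obtain ⟨τ, hτ, hle⟩ := hrev.exists_isMixingTime_le (K := 9 * q) (by linarith) hM hε hε1 hmin
      (by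
        rintro σ (rfl | rfl) f hf
        · exact hrev.gap_one hconn htrans hb hc (by linarith) (by rw [hKc]; linarith) hf
        · refine hrev.gap_neg_one hconn htrans hbip hb hc (by linarith) ?_ f
          rw [hKc]
          nlinarith)
    exact ⟨τ, hτ, hle.trans hfinal⟩
  · obtain ⟨τ, hτ, hle⟩ := hrev.lazy.exists_isMixingTime_le (K := 9 * q) (by linarith) hM hε hε1
      hmin (by
        rintro σ (rfl | rfl) f hf
        · refine hrev.lazy.gap_one hconn htrans hb hcl (by linarith) ?_ hf
          -- Laziness halves the edge weights; the slack between 9 and 2 absorbs this.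
          rw [← mul_div_assoc (9 * q), hKc]
          linarith
        · refine hrev.lazy.gap_neg_one_of_half_le (fun x => ?_) (by linarith) f
          have := hrev.nonneg x x
          simp only [lazyMatrix, Matrix.smul_apply, Matrix.add_apply, smul_eq_mul,
            Matrix.one_apply_eq]
          linarith)
    exact ⟨τ, hτ, hle.trans hfinal⟩
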